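/- Let $d\in\mathbb N$, let $B_d$ be the open unit ball of $\mathbb C^d$, let $k(x,y)=\frac{1}{1-\langle x,y\rangle}$ for $x,y\in B_d$, and let $\mathcal H^2_d$ be the Drury–Arveson space, i.e. the reproducing kernel Hilbert space on $B_d$ with kernel $k$ and kernel functions $k_x=k(\cdot,x)$. A variety in $B_d$ is the common zero set in $B_d$ of a non-empty subset of $\mathcal H^2_d$. For a variety $V$ let $H_V=\overline{\operatorname{span}}\{k_x:x\in V\}\subseteq\mathcal H^2_d$, regarded, by restriction to $V$, as a reproducing kernel Hilbert space on $V$, and let $\mathcal M_V=\{f:V\to\mathbb C : fg\in H_V\text{ for all }g\in H_V\}$ be its multiplier algebra; a matrix in $M_m(\mathcal M_V)$ is normed as a multiplication operator on $H_V\oplus\dots\oplus H_V$ ($m$ summands). For an algebra homomorphism $\varphi:\mathcal M_V\to\mathcal M_W$ put $\|\varphi\|_{cb}=\sup_{m\ge 1}\|\varphi^{(m)}\|$, where $\varphi^{(m)}[f_{ij}]=[\varphi(f_{ij})]$. Theorem. Let $V\subseteq B_d$ be a variety that contains at least two points, and let $(W_n)_{n\in\mathbb N}$ be a sequence of varieties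 in $B_d$. Assume that for every $n$ there are a bijection $F_n:V\to W_n$, a nowhere vanishing function $\delta_n:V\to\mathbb C$, and a bounded invertible linear map $T_{F_n}:H_V\to H_{W_n}$ with $$T_{F_n}(k_x)=\delta_n(x)\,k_{F_n(x)},\qquad x\in V$$ (an RKHS isomorphism). Then for every $n$ the formula $\varphi_{F_n}(f)=f\circ F_n^{-1}$, $f\in\mathcal M_V$, defines an algebra isomorphism $\varphi_{F_n}:\mathcal M_V\to\mathcal M_{W_n}$ which is completely bounded with completely bounded inverse (a multiplier algebra isomorphism); and if $$\|T_{F_n}\|\,\|T_{F_n}^{-1}\|\xrightarrow[n\to\infty]{}1,$$ then $$\|\varphi_{F_n}\|_{cb}\,\|\varphi_{F_n}^{-1}\|_{cb}\xrightarrow[n\to\infty]{}1.$$ -/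

import Mathlib

open scoped ENNReal Topology
open Filter

noncomputable section

namespace DruryArveson

/-! ### Multiplier algebras of (scalar) reproducing kernel Hilbert spaces -/

section Multipliers

variable {X Y : Type*}
variable (H : Type*) [NormedAddCommGroup H] [InnerProductSpace ℂ H] [RKHS ℂ H X ℂ]
variable (K : Type*) [NormedAddCommGroup K] [InnerProductSpace ℂ K] [RKHS ℂ K Y ℂ]

/-- The multiplier algebra `Mult(H)` of a reproducing kernel Hilbert space `H` of complex functions
on `X`: all `f : X → ℂ` with `f · g ∈ H` for every `g ∈ H`. -/
def Mult : Subalgebra ℂ (X → ℂ) where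
  carrier := {f | ∀ g : H, ∃ h : H, ∀ x, h x = f x * g x}
  mul_mem' := by
    intro a b ha hb g
    obtain ⟨h, hh⟩ := hb g
    obtain ⟨k, hk⟩ := ha h
    exact ⟨k, fun x => by rw [hk, hh, Pi.mul_apply, mul_assoc]⟩
  add_mem' := by
    intro a b ha hb g
    obtain ⟨h, hh⟩ := ha g
    obtain ⟨k, hk⟩ := hb g
    exact ⟨h + k, fun x => by
      rw [RKHS.coe_add, Pi.add_apply, hh, hk, Pi.add_apply, add_mul]⟩
  algebraMap_mem' := by
    intro r g
    exact ⟨r • g, fun x => by rw [RKHS.coe_smul]; rfl⟩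

variable {H}

/-- The product `f · g ∈ H` of a multiplier `f` and an element `g` of `H`. -/
def Mult.mul (f : Mult H) (g : H) : H := (f.2 g).choose

lemma Mult.mul_apply (f : Mult H) (g : H) (x : X) :
    Mult.mul f g x = (f : X → ℂ) x * g x := (f.2 g).choose_spec x

/-- Multiplication by `f` as a linear map. -/
def Mult.mulLinear (f : Mult H) : H →ₗ[ℂ] H where
  toFun := Mult.mul f
  map_add' g h := by
    apply RKHS.ext
    intro x
    simp only [RKHS.coe_add, Pi.add_apply, Mult.mul_apply]
    ring
  map_smul' c g := by
    apply RKHS.ext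
    intro x
    simp only [RKHS.coe_smul, Pi.smul_apply, Mult.mul_apply, smul_eq_mul, RingHom.id_apply]
    ring

/-- The multiplication operator `M_f g = f · g` on `H`; it is bounded by the closed graph
theorem. -/
def Mult.op [CompleteSpace H] (f : Mult H) : H →L[ℂ] H where
  toLinearMap := Mult.mulLinear f
  cont := by
    apply LinearMap.continuous_of_seq_closed_graph
    intro u g h hu hh
    apply RKHS.ext
    intro x
    have h1 := ((RKHS.continuous_eval x).tendsto h).comp hh
    have h2 := (((RKHS.continuous_eval x).tendsto g).comp hu).const_mul ((f : X → ℂ) x)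
    refine (tendsto_nhds_unique h1 (h2.congr fun n => ?_)).trans (Mult.mul_apply f g x).symm
    exact (Mult.mul_apply f (u n) x).symm

/-- The operator on the Hilbert space `H ⊕ ⋯ ⊕ H` (`n` copies) given by an `n × n` matrix of
multipliers, `(A g)_i = ∑ j, f_{i j} g_j`. -/
def matrixOp [CompleteSpace H] {n : ℕ} (A : Matrix (Fin n) (Fin n) (Mult H)) :
    PiLp 2 (fun _ : Fin n => H) →L[ℂ] PiLp 2 (fun _ : Fin n => H) :=
  (PiLp.continuousLinearEquiv 2 ℂ (fun _ : Fin n => H)).symm.toContinuousLinearMap ∘L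
    ContinuousLinearMap.pi fun i =>
      ∑ j, Mult.op (A i j) ∘L PiLp.proj 2 (fun _ : Fin n => H) j

variable {K}

/-- The norm of the amplification `φ⁽ⁿ⁾ : M_n(Mult H) → M_n(Mult K)`, `[f_{i j}] ↦ [φ (f_{i j})]`,
as a possibly infinite quantity: the supremum of `‖φ⁽ⁿ⁾ A‖` over the closed unit ball of
`M_n(Mult H)`, matrices of multipliers being normed as operators. -/
def ampNorm [CompleteSpace H] [CompleteSpace K] (φ : Mult H →ₐ[ℂ] Mult K) (n : ℕ) : ℝ≥0∞ :=
  ⨆ (A : Matrix (Fin n) (Fin n) (Mult H)) (_ : ‖matrixOp A‖ ≤ 1), ‖matrixOp (A.map φ)‖ₑ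

/-- The completely bounded norm `‖φ‖_cb = sup_n ‖φ⁽ⁿ⁾‖`, possibly infinite
(the index `n = 0` contributes `0`). -/
def cbNorm [CompleteSpace H] [CompleteSpace K] (φ : Mult H →ₐ[ℂ] Mult K) : ℝ≥0∞ :=
  ⨆ n : ℕ, ampNorm φ n

/-- `φ : Mult(H) → Mult(K)` is a multiplier algebra isomorphism implemented by the bijection
`G : Y → X`: it is a completely bounded algebra isomorphism with completely bounded inverse, and
`φ(f) = f ∘ G`. -/
structure IsMultiplierAlgebraIso [CompleteSpace H] [CompleteSpace K]
    (φ : Mult H ≃ₐ[ℂ] Mult K) (G : Y ≃ X) : Prop where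
  cb : cbNorm φ.toAlgHom < ∞
  cb_symm : cbNorm φ.symm.toAlgHom < ∞
  apply_eq : ∀ (f : Mult H) (y : Y), (φ f : Y → ℂ) y = (f : X → ℂ) (G y)

end Multipliers

/-! ### The Drury–Arveson space -/

/-- The open unit ball `B_d` of `ℂ^d`. -/
abbrev Ball (d : ℕ) : Type := Metric.ball (0 : EuclideanSpace ℂ (Fin d)) 1

/-- The kernel `k(x, y) = 1 / (1 - ⟨x, y⟩)`, where `⟨x, y⟩` is linear in `x`
(so it is `inner ℂ y x`). -/
def ker {d : ℕ} (x y : Ball d) : ℂ :=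
  1 / (1 - inner ℂ (y : EuclideanSpace ℂ (Fin d)) (x : EuclideanSpace ℂ (Fin d)))

/-- The kernel `k` as an operator-valued matrix (scalars acting on `ℂ`). -/
def kerMatrix (d : ℕ) : Matrix (Ball d) (Ball d) (ℂ →L[ℂ] ℂ) :=
  Matrix.of fun x y => ker x y • ContinuousLinearMap.id ℂ ℂ

lemma norm_inner_lt_one {d : ℕ} (x y : Ball d) :
    ‖inner ℂ (y : EuclideanSpace ℂ (Fin d)) (x : EuclideanSpace ℂ (Fin d))‖ < 1 := by
  have hx : ‖(x : EuclideanSpace ℂ (Fin d))‖ < 1 := mem_ball_zero_iff.mp x.2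
  have hy : ‖(y : EuclideanSpace ℂ (Fin d))‖ < 1 := mem_ball_zero_iff.mp y.2
  calc _ ≤ ‖(y : EuclideanSpace ℂ (Fin d))‖ * ‖(x : EuclideanSpace ℂ (Fin d))‖ :=
        norm_inner_le_norm _ _
    _ < 1 := by nlinarith [norm_nonneg (x : EuclideanSpace ℂ (Fin d)),
        norm_nonneg (y : EuclideanSpace ℂ (Fin d))]

lemma hasSum_ker {d : ℕ} (x y : Ball d) :
    HasSum (fun n : ℕ =>
      (inner ℂ (y : EuclideanSpace ℂ (Fin d)) (x : EuclideanSpace ℂ (Fin d))) ^ n) (ker x y) := by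
  rw [ker, one_div]
  exact hasSum_geometric_of_norm_lt_one (norm_inner_lt_one x y)

lemma conj_ker {d : ℕ} (x y : Ball d) : (starRingEnd ℂ) (ker x y) = ker y x := by
  simp [ker]

open scoped ComplexOrder in
theorem posSemidef_kerMatrix (d : ℕ) : (kerMatrix d).PosSemidef := by
  have hiff : (kerMatrix d).PosSemidef ↔ (kerMatrix d).IsHermitian ∧ ∀ v : Ball d →₀ ℂ,
      0 ≤ RCLike.re (v.sum fun x a => v.sum fun y b => inner ℂ (kerMatrix d y x a) b) :=
    (RKHS.posSemidef_tfae (K := kerMatrix d)).out 0 2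
  refine hiff.mpr ⟨?_, fun v => ?_⟩
  · ext x y
    simp [kerMatrix, conj_ker, ContinuousLinearMap.star_eq_adjoint,
      ContinuousLinearMap.adjoint_id]
  · simp only [Finsupp.sum]
    have key : HasSum (fun n : ℕ => ∑ x ∈ v.support, ∑ y ∈ v.support,
        (starRingEnd ℂ (v x) * v y) *
          (inner ℂ (y : EuclideanSpace ℂ (Fin d)) (x : EuclideanSpace ℂ (Fin d))) ^ n)
        (∑ x ∈ v.support, ∑ y ∈ v.support, inner ℂ (kerMatrix d y x (v x)) (v y)) := by
      refine hasSum_sum fun x _ => hasSum_sum fun y _ => ?_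
      have := (hasSum_ker x y).mul_left (starRingEnd ℂ (v x) * v y)
      convert! this using 1
      simp [kerMatrix, conj_ker]
      ring
    refine (Complex.hasSum_re key).nonneg fun n => ?_
    have hn : ∑ x ∈ v.support, ∑ y ∈ v.support, (starRingEnd ℂ (v x) * v y) *
          (inner ℂ (y : EuclideanSpace ℂ (Fin d)) (x : EuclideanSpace ℂ (Fin d))) ^ n =
        ∑ p : Fin n → Fin d,
          (∑ x ∈ v.support, starRingEnd ℂ (v x) * ∏ i, x.1 (p i)) *
            (∑ y ∈ v.support, v y * ∏ i, starRingEnd ℂ (y.1 (p i))) := by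
      simp only [Finset.sum_mul_sum]
      rw [Finset.sum_comm]
      simp only [PiLp.inner_apply, RCLike.inner_apply, Fintype.sum_pow, Finset.mul_sum,
        Finset.prod_mul_distrib]
      rw [Finset.sum_comm]
      symm
      rw [Finset.sum_comm]
      refine Finset.sum_congr rfl fun x _ => ?_
      rw [Finset.sum_comm]
      refine Finset.sum_congr rfl fun y _ => Finset.sum_congr rfl fun p _ => ?_
      ring
    rw [hn, Complex.re_sum]
    refine Finset.sum_nonneg fun p _ => ?_
    have hc : ∑ x ∈ v.support, starRingEnd ℂ (v x) * ∏ i, x.1 (p i) =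
        starRingEnd ℂ (∑ y ∈ v.support, v y * ∏ i, starRingEnd ℂ (y.1 (p i))) := by
      simp [map_sum, map_prod]
    rw [hc, mul_comm, Complex.mul_conj, Complex.ofReal_re]
    exact Complex.normSq_nonneg _

instance factPosSemidefKerMatrix (d : ℕ) :
    Fact (Matrix.PosSemidef (kerMatrix d)) := ⟨posSemidef_kerMatrix d⟩

/-- The Drury–Arveson space `H²_d`: the reproducing kernel Hilbert space on `B_d` with
kernel `k`. -/
abbrev Space (d : ℕ) : Type := RKHS.OfKernel (kerMatrix d)

/-- The kernel function `k_x ∈ H²_d`. -/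
def kerFun {d : ℕ} (x : Ball d) : Space d := RKHS.kerFun (Space d) x 1

/-- `V ⊆ B_d` is a variety: the common zero set of a non-empty family of functions in `H²_d`. -/
def IsVariety {d : ℕ} (V : Set (Ball d)) : Prop :=
  ∃ S : Set (Space d), S.Nonempty ∧ V = {x | ∀ f ∈ S, f x = 0}

/-- `H_V`, the closed span of `{k_x : x ∈ V}` in `H²_d`. -/
def HV {d : ℕ} (V : Set (Ball d)) : Submodule ℂ (Space d) :=
  (Submodule.span ℂ (kerFun '' V)).topologicalClosure

instance completeSpaceHV {d : ℕ} (V : Set (Ball d)) : CompleteSpace (HV V) :=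
  (Submodule.isClosed_topologicalClosure _).completeSpace_coe

lemma kerFun_mem_HV {d : ℕ} {V : Set (Ball d)} (x : V) : kerFun (x : Ball d) ∈ HV V :=
  Submodule.le_topologicalClosure _ (Submodule.subset_span ⟨x, x.2, rfl⟩)

/-- The kernel function `k_x`, `x ∈ V`, as an element of `H_V`. -/
def kerV {d : ℕ} {V : Set (Ball d)} (x : V) : HV V := ⟨kerFun (x : Ball d), kerFun_mem_HV x⟩

/-- `H_V` as a reproducing kernel Hilbert space of functions on `V`: an element of `H_V ⊆ H²_d` is
identified with its restriction to `V`. -/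
instance rkhsHV {d : ℕ} (V : Set (Ball d)) : RKHS ℂ (HV V) V ℂ where
  coeCLM := (ContinuousLinearMap.pi fun x : V =>
    ContinuousLinearMap.proj (R := ℂ) (φ := fun _ : Ball d => ℂ) (x : Ball d)) ∘L
      RKHS.coeCLM ℂ ∘L (HV V).subtypeL
  coeCLM_injective := by
    refine (injective_iff_map_eq_zero _).mpr fun f hf => ?_
    have h1 : ∀ x ∈ V, (f : Space d) x = 0 := fun x hx => congrFun hf ⟨x, hx⟩
    have h2 : HV V ≤ (Submodule.span ℂ {(f : Space d)})ᗮ := by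
      refine Submodule.topologicalClosure_minimal _ (Submodule.span_le.mpr ?_)
        (Submodule.isClosed_orthogonal _)
      rintro _ ⟨x, hx, rfl⟩
      refine Submodule.mem_orthogonal_singleton_iff_inner_right.mpr ?_
      simp [kerFun, h1 x hx]
    have h3 := Submodule.mem_orthogonal_singleton_iff_inner_right.mp (h2 f.2)
    exact Subtype.ext (inner_self_eq_zero.mp h3)

/-- The multiplier algebra `M_V = Mult(H_V)`. -/
abbrev MV {d : ℕ} (V : Set (Ball d)) : Subalgebra ℂ (V → ℂ) := Mult (HV V)

/-- A bounded invertible linear map `T : H_V → H_W` is an RKHS isomorphism, implemented by the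
bijection `F : V → W` and the nowhere vanishing function `δ : V → ℂ`, if
`T k_x = δ(x) k_{F(x)}` for `x ∈ V`. -/
structure IsRKHSIso {d : ℕ} {V W : Set (Ball d)} (T : HV V ≃L[ℂ] HV W) (F : V ≃ W) (δ : V → ℂ) :
    Prop where
  ne_zero : ∀ x, δ x ≠ 0
  map_ker : ∀ x, T (kerV x) = δ x • kerV (F x)

end DruryArveson

end

/-!
The adjoint of an RKHS isomorphism `T k_x = δ(x) k_{F(x)}` is the weighted composition operator
`(T* g)(x) = conj δ(x) · g(F(x))`. Conjugating a multiplication operator `M_f` by a weighted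
composition operator cancels the weights and leaves multiplication by `f ∘ F⁻¹`. Hence
`φ(f) = f ∘ F⁻¹` maps multipliers to multipliers, and `M_{φ(f)} = (T*)⁻¹ M_f T*`. The same identity
holds for the diagonal amplifications, so `‖φ‖_cb ≤ ‖T‖ ‖T⁻¹‖` (`cbNorm_le`); by symmetry this bounds
`‖φ⁻¹‖_cb` as well. Since unital homomorphisms have `‖·‖_cb ≥ 1` (`one_le_cbNorm`), one gets
`1 ≤ ‖φ‖_cb ‖φ⁻¹‖_cb ≤ (‖T‖ ‖T⁻¹‖)²`, and the limit follows by squeezing.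
-/

open scoped ENNReal Topology
open Filter

namespace DruryArveson

section WeightedComposition

variable {X Y H K : Type*}
variable [NormedAddCommGroup H] [InnerProductSpace ℂ H] [RKHS ℂ H X ℂ]
variable [NormedAddCommGroup K] [InnerProductSpace ℂ K] [RKHS ℂ K Y ℂ]

/-- `R : K → H` is the weighted composition operator `g ↦ w · (g ∘ F)`. -/
def IsWeightedComp (R : K →L[ℂ] H) (F : X → Y) (w : X → ℂ) : Prop :=
  ∀ g x, R g x = w x * g (F x)

lemma comp_mem_mult {R : K →L[ℂ] H} {S : H →L[ℂ] K} {F : X → Y} {G : Y → X} {w : X → ℂ}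
    {v : Y → ℂ} (hR : IsWeightedComp R F w) (hS : IsWeightedComp S G v)
    (hFG : ∀ y, F (G y) = y) (hvw : ∀ y, v y * w (G y) = 1) {f : X → ℂ} (hf : f ∈ Mult H) :
    f ∘ G ∈ Mult K := by
  intro g
  obtain ⟨h, hh⟩ := hf (R g)
  refine ⟨S h, fun y => ?_⟩
  rw [hS, hh, hR, hFG, Function.comp_apply]
  linear_combination f (G y) * g y * hvw y

/-- The operator identity `M_{f'} = S M_f R` for `f' = f ∘ G`. -/
lemma mul_eq_of_isWeightedComp {R : K →L[ℂ] H} {S : H →L[ℂ] K} {F : X → Y} {G : Y → X}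
    {w : X → ℂ} {v : Y → ℂ} (hR : IsWeightedComp R F w) (hS : IsWeightedComp S G v)
    (hFG : ∀ y, F (G y) = y) (hvw : ∀ y, v y * w (G y) = 1) {f : Mult H} {f' : Mult K}
    (hf : ∀ y, (f' : Y → ℂ) y = (f : X → ℂ) (G y)) (g : K) :
    Mult.mul f' g = S (Mult.mul f (R g)) := by
  apply RKHS.ext
  intro y
  rw [Mult.mul_apply, hS, Mult.mul_apply, hR, hFG, hf]
  linear_combination (-(f : X → ℂ) (G y) * g y) * hvw y

/-- The algebra isomorphism `f ↦ f ∘ F⁻¹` of multiplier algebras, for a bijection `F` such that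
composition with `F` and with `F⁻¹` preserves multipliers. -/
def compAlgEquiv (F : X ≃ Y) (h : ∀ f ∈ Mult H, f ∘ F.symm ∈ Mult K)
    (h' : ∀ f ∈ Mult K, f ∘ F ∈ Mult H) : Mult H ≃ₐ[ℂ] Mult K where
  toFun f := ⟨(f : X → ℂ) ∘ F.symm, h _ f.2⟩
  invFun f := ⟨(f : Y → ℂ) ∘ F, h' _ f.2⟩
  left_inv f := by ext x; simp
  right_inv f := by ext y; simp
  map_mul' _ _ := rfl
  map_add' _ _ := rfl
  commutes' _ := rfl

end WeightedComposition

section Norms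

variable {X Y H K : Type*}
variable [NormedAddCommGroup H] [InnerProductSpace ℂ H] [RKHS ℂ H X ℂ] [CompleteSpace H]
variable [NormedAddCommGroup K] [InnerProductSpace ℂ K] [RKHS ℂ K Y ℂ] [CompleteSpace K]

lemma matrixOp_apply {n : ℕ} (A : Matrix (Fin n) (Fin n) (Mult H))
    (g : PiLp 2 (fun _ : Fin n => H)) (i : Fin n) :
    matrixOp A g i = ∑ j, Mult.mul (A i j) (g j) := by
  simp [matrixOp, Mult.op, Mult.mulLinear]

lemma matrixOp_one (n : ℕ) :
    matrixOp (1 : Matrix (Fin n) (Fin n) (Mult H)) = ContinuousLinearMap.id ℂ _ := by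
  ext g i : 2
  rw [matrixOp_apply]
  apply RKHS.ext
  intro x
  have hval : ∀ (s : Finset (Fin n)) (u : Fin n → H), (∑ j ∈ s, u j) x = ∑ j ∈ s, u j x :=
    fun s u => map_sum ((ContinuousLinearMap.proj x).comp (RKHS.coeCLM ℂ : H →L[ℂ] X → ℂ)) u s
  rw [hval, Finset.sum_eq_single i]
  · simp [Mult.mul_apply]
  · intro j _ hj
    simp [Mult.mul_apply, Matrix.one_apply_ne hj.symm]
  · simp

lemma norm_piLp_le_of_forall_le {ι E E' : Type*} [Fintype ι] [SeminormedAddCommGroup E]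
    [SeminormedAddCommGroup E'] {c : ℝ} (hc : 0 ≤ c) (u : PiLp 2 (fun _ : ι => E))
    (v : PiLp 2 (fun _ : ι => E')) (h : ∀ i, ‖u i‖ ≤ c * ‖v i‖) : ‖u‖ ≤ c * ‖v‖ := by
  refine le_of_sq_le_sq ?_ (by positivity)
  rw [mul_pow, PiLp.norm_sq_eq_of_L2, PiLp.norm_sq_eq_of_L2, Finset.mul_sum]
  refine Finset.sum_le_sum fun i _ => ?_
  rw [← mul_pow]
  exact pow_le_pow_left₀ (norm_nonneg _) (h i) 2

/-- A homomorphism implemented by `M_{φ(f)} = S M_f R` has cb norm at most `‖S‖ ‖R‖`, because the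
same identity holds for matrices, with `S` and `R` acting diagonally. -/
lemma cbNorm_le (φ : Mult H →ₐ[ℂ] Mult K) (R : K →L[ℂ] H) (S : H →L[ℂ] K)
    (h : ∀ (f : Mult H) (g : K), Mult.mul (φ f) g = S (Mult.mul f (R g))) :
    cbNorm φ ≤ ENNReal.ofReal (‖S‖ * ‖R‖) := by
  refine iSup_le fun n => iSup₂_le fun A hA => ?_
  rw [← ofReal_norm]
  refine ENNReal.ofReal_le_ofReal ?_
  refine ContinuousLinearMap.opNorm_le_bound _ (by positivity) fun g => ?_
  set Rg : PiLp 2 (fun _ : Fin n => H) := WithLp.toLp 2 fun j => R (g j) with hRg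
  have h1 : ‖Rg‖ ≤ ‖R‖ * ‖g‖ :=
    norm_piLp_le_of_forall_le (norm_nonneg _) _ _ fun i => R.le_opNorm _
  have h2 : ‖matrixOp A Rg‖ ≤ ‖Rg‖ := by
    simpa using (matrixOp A).le_of_opNorm_le hA Rg
  have h3 : ‖matrixOp (A.map φ) g‖ ≤ ‖S‖ * ‖matrixOp A Rg‖ := by
    refine norm_piLp_le_of_forall_le (norm_nonneg _) _ _ fun i => ?_
    have : matrixOp (A.map φ) g i = S (matrixOp A Rg i) := by
      simp only [matrixOp_apply, map_sum, Matrix.map_apply, h, hRg]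
    rw [this]
    exact S.le_opNorm _
  calc _ ≤ ‖S‖ * ‖matrixOp A Rg‖ := h3
    _ ≤ ‖S‖ * (‖R‖ * ‖g‖) := by gcongr; exact h2.trans h1
    _ = ‖S‖ * ‖R‖ * ‖g‖ := by ring

lemma one_le_cbNorm [Nontrivial K] (φ : Mult H →ₐ[ℂ] Mult K) : 1 ≤ cbNorm φ := by
  refine le_trans ?_ (le_iSup _ 1)
  have hA : ‖matrixOp (1 : Matrix (Fin 1) (Fin 1) (Mult H))‖ ≤ 1 := by
    rw [matrixOp_one]
    exact ContinuousLinearMap.norm_id_le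
  refine le_trans ?_ 
    (le_iSup₂ (f := fun (A : Matrix (Fin 1) (Fin 1) (Mult H)) (_ : ‖matrixOp A‖ ≤ 1) =>
      ‖matrixOp (A.map φ)‖ₑ) 1 hA)
  rw [Matrix.map_one _ (map_zero φ) (map_one φ), matrixOp_one, ← ofReal_norm]
  simp [ContinuousLinearMap.norm_id]

end Norms

section DruryArvesonSpace

variable {d : ℕ} {V W : Set (Ball d)}

/-- The reproducing property. The `Inner` instance is given explicitly, since instance search
takes one that is not syntactically that of the inner product space `H_V`. -/
lemma inner_kerV (x : V) (g : HV V) :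
    @inner ℂ (HV V) InnerProductSpace.toInner (kerV x) g = g x := by
  change inner ℂ (kerFun (x : Ball d)) (g : Space d) = (g : Space d) (x : Ball d)
  simp [kerFun]

lemma kerV_ne_zero (x : V) : kerV x ≠ 0 := by
  intro h
  have h1 : kerFun (x : Ball d) = 0 := congrArg Subtype.val h
  have h2 : kerFun (x : Ball d) (x : Ball d) = 0 := by rw [h1]; simp
  rw [kerFun, RKHS.kerFun_apply, RKHS.OfKernel.kernel_ofKernel] at h2
  have h3 : ker (x : Ball d) x = 0 := by simpa [kerMatrix] using h2
  rw [ker, one_div, inv_eq_zero, sub_eq_zero] at h3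
  have h4 := norm_inner_lt_one (x : Ball d) x
  rw [← h3, norm_one] at h4
  exact lt_irrefl _ h4

lemma nontrivial_HV (hV : V.Nonempty) : Nontrivial (HV V) :=
  ⟨kerV ⟨_, hV.some_mem⟩, 0, kerV_ne_zero _⟩

lemma IsRKHSIso.symm {T : HV V ≃L[ℂ] HV W} {F : V ≃ W} {δ : V → ℂ} (h : IsRKHSIso T F δ) :
    IsRKHSIso T.symm F.symm fun y => (δ (F.symm y))⁻¹ where
  ne_zero y := inv_ne_zero (h.ne_zero _)
  map_ker y := by
    rw [T.symm_apply_eq, map_smul, h.map_ker, smul_smul, inv_mul_cancel₀ (h.ne_zero _), one_smul,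
      F.apply_symm_apply]

/-- The adjoint of an RKHS isomorphism is the weighted composition operator
`g ↦ conj δ · (g ∘ F)`. -/
lemma IsRKHSIso.isWeightedComp_adjoint {T : HV V ≃L[ℂ] HV W} {F : V ≃ W} {δ : V → ℂ}
    (h : IsRKHSIso T F δ) :
    IsWeightedComp (ContinuousLinearMap.adjoint (T : HV V →L[ℂ] HV W)) F
      fun x => starRingEnd ℂ (δ x) := by
  intro g x
  rw [← inner_kerV, ContinuousLinearMap.adjoint_inner_right, ContinuousLinearEquiv.coe_coe,
    h.map_ker]
  exact (inner_smul_left _ _ _).trans (congrArg _ (inner_kerV (F x) g))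

/-- An RKHS isomorphism induces the isomorphism `φ(f) = f ∘ F⁻¹` of multiplier algebras, with
`‖φ‖_cb` and `‖φ⁻¹‖_cb` at most `‖T‖ ‖T⁻¹‖`. -/
lemma IsRKHSIso.exists_algEquiv {T : HV V ≃L[ℂ] HV W} {F : V ≃ W} {δ : V → ℂ}
    (h : IsRKHSIso T F δ) :
    ∃ φ : MV V ≃ₐ[ℂ] MV W,
      (∀ (f : MV V) (y : W), (φ f : W → ℂ) y = (f : V → ℂ) (F.symm y)) ∧
      cbNorm φ.toAlgHom ≤ ENNReal.ofReal
        (‖(T : HV V →L[ℂ] HV W)‖ * ‖(T.symm : HV W →L[ℂ] HV V)‖) ∧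
      cbNorm φ.symm.toAlgHom ≤ ENNReal.ofReal
        (‖(T : HV V →L[ℂ] HV W)‖ * ‖(T.symm : HV W →L[ℂ] HV V)‖) := by
  have hR := h.isWeightedComp_adjoint
  have hS := h.symm.isWeightedComp_adjoint
  have hvw : ∀ y : W, starRingEnd ℂ (δ (F.symm y))⁻¹ * starRingEnd ℂ (δ (F.symm y)) = 1 := by
    intro y
    rw [← map_mul, inv_mul_cancel₀ (h.ne_zero _), map_one]
  have hwv : ∀ x : V, starRingEnd ℂ (δ x) * starRingEnd ℂ (δ (F.symm (F x)))⁻¹ = 1 := by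
    intro x
    rw [F.symm_apply_apply, ← map_mul, mul_inv_cancel₀ (h.ne_zero _), map_one]
  refine ⟨compAlgEquiv F (fun f hf => comp_mem_mult hR hS F.apply_symm_apply hvw hf)
    (fun f hf => comp_mem_mult hS hR F.symm_apply_apply hwv hf), fun f y => rfl, ?_, ?_⟩
  · refine (cbNorm_le _ _ _ fun f g =>
      mul_eq_of_isWeightedComp hR hS F.apply_symm_apply hvw (fun y => rfl) g).trans_eq ?_
    rw [LinearIsometryEquiv.norm_map, LinearIsometryEquiv.norm_map, mul_comm]
  · refine (cbNorm_le _ _ _ fun f g =>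
      mul_eq_of_isWeightedComp hS hR F.symm_apply_apply hwv (fun y => rfl) g).trans_eq ?_
    rw [LinearIsometryEquiv.norm_map, LinearIsometryEquiv.norm_map]

end DruryArvesonSpace

end DruryArveson

theorem theorem8p0p4 {d : ℕ} (V : Set (DruryArveson.Ball d))
    (hV : DruryArveson.IsVariety V) (hV2 : V.Nontrivial)
    (W : ℕ → Set (DruryArveson.Ball d)) (hW : ∀ n, DruryArveson.IsVariety (W n))
    (F : ∀ n, V ≃ W n) (δ : ℕ → V → ℂ)
    (T : ∀ n, DruryArveson.HV V ≃L[ℂ] DruryArveson.HV (W n))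
    (hT : ∀ n, DruryArveson.IsRKHSIso (T n) (F n) (δ n)) :
    ∃ φ : ∀ n, DruryArveson.MV V ≃ₐ[ℂ] DruryArveson.MV (W n),
      (∀ n, DruryArveson.IsMultiplierAlgebraIso (φ n) (F n).symm) ∧
      (Tendsto
        (fun n => ‖(T n : DruryArveson.HV V →L[ℂ] DruryArveson.HV (W n))‖ *
          ‖((T n).symm : DruryArveson.HV (W n) →L[ℂ] DruryArveson.HV V)‖) atTop (𝓝 1) →
      Tendsto
        (fun n => DruryArveson.cbNorm (φ n).toAlgHom *
          DruryArveson.cbNorm (φ n).symm.toAlgHom) atTop (𝓝 1)) := by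
  choose φ hφ hcb hcb' using fun n => (hT n).exists_algEquiv
  refine ⟨φ, fun n => ⟨(hcb n).trans_lt ENNReal.ofReal_lt_top,
    (hcb' n).trans_lt ENNReal.ofReal_lt_top, hφ n⟩, fun hlim => ?_⟩
  have : Nontrivial (DruryArveson.HV V) := DruryArveson.nontrivial_HV hV2.nonempty
  have hlim' := ENNReal.tendsto_ofReal hlim
  have hup := ENNReal.Tendsto.mul hlim' (by simp) hlim' (by simp)
  rw [ENNReal.ofReal_one, one_mul] at hup
  refine tendsto_of_tendsto_of_tendsto_of_le_of_le tendsto_const_nhds hup (fun n => ?_)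
    fun n => mul_le_mul' (hcb n) (hcb' n)
  have : Nontrivial (DruryArveson.HV (W n)) := (T n).injective.nontrivial
  exact one_le_mul (DruryArveson.one_le_cbNorm _) (DruryArveson.one_le_cbNorm _)
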